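/- Let $X$ be a second-countable locally compact Hausdorff space, and let $\kappa:X\times X\to[0,\infty]$ be a symmetric lower semicontinuous kernel. For Radon measures $\mu,\nu$ on $X$ put $U^\mu(x)=\int\kappa(x,y)\,d\mu(y)$, $I(\mu,\nu)=\int\kappa\,d(\mu\otimes\nu)$, $I(\mu)=I(\mu,\mu)$, whenever these are well defined. Let $\mathcal E$ be the space of signed Radon measures of finite energy, with $\|\mu\|^2=I(\mu)$ (whose topology is called strong), let $\mathcal E^+$ be the cone of positive measures in $\mathcal E$, and for $A\subset X$ let $\mathcal E^+(A)$ be the set of $\mu\in\mathcal E^+$ concentrated on $A$ (that is, $X\setminus A$ is $\mu$-negligible). Assume that $\kappa$ satisfies: - the energy principle: $I(\mu)\ge0$ for every signed Radon measure $\mu$ whose energy is well defined, with $I(\mu)=0$ only for $\mu=0$; - the consistency principle: $\mathcal E^+$ is strongly complete, and on $\mathcal E^+$ the strong topology is finer than the vague topology; - the domination principle: if $\mu\in\mathcal E^+$, $\nu$ is a positive Radon measure and $U^\mu\le U^\nu$ $\mu$-a.e., then $U^\mu\le U^\nu$ on $X$; - Frostman's maximum principle: if $\mu\in\mathcal E^+$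 and $U^\mu\le c$ $\mu$-a.e. with $c\in(0,\infty)$, then $U^\mu\le c$ on $X$. For compact $K\subset X$ let $c(K)=1/\inf I(\mu)$, the infimum being over the positive measures $\mu$ of unit mass concentrated on $K$, and for $E\subset X$ let $c_*(E)=\sup\{c(K):K\subset E\text{ compact}\}$ be its inner capacity. A property holds nearly everywhere (n.e.) on a set if the subset where it fails has inner capacity zero. Let $A\subset X$ be a set with $c_*(A)>0$ such that $\mathcal E^+(A)$ is strongly closed. Let $\omega\ne0$ be a positive Radon measure on $X$ such that either $\omega\in\mathcal E^+$, or else $\omega(X)<\infty$, $\sup_AU^\omega<\infty$, and $U^\omega|_K$ is upper semicontinuous for each compact $K\subset A$. Let $\omega^A$ be the inner balayage of $\omega$ onto $A$, that is, the unique measure in $\mathcal E^+(A)$ with $U^{\omega^A}=U^\omega$ n.e. on $A$. **Theorem.** Suppose that $A$ is unbounded (that is, not relatively compact in $X$), that $\omega^A(X)>1$, and that $U^\omega(x)\to0$ as $x\in A$ tends to the Alexandroff point $\infty_X$ of $X$. Then there is a unique measure $\lambda_{A,f}$ minimizing $$I_f(\mu)=\|\mu\|^2-2\int U^\omega\,d\mu\qquad(\text{that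 is, with the external field } f=-U^\omega)$$ over all $\mu\in\mathcal E^+(A)$ with $\mu(X)=1$, and $\lambda_{A,f}$ has compact support. -/

import Mathlib

open MeasureTheory Filter Topology Set
open scoped ENNReal NNReal CompactlySupported

namespace Balayage

noncomputable section

variable {X : Type*} [TopologicalSpace X] [MeasurableSpace X]

/-! Throughout, `X` is meant to be a second-countable locally compact Hausdorff space with its Borel
σ-algebra. On such a space the positive Radon measures are exactly the locally finite Borel
measures (regularity is automatic). A signed Radon measure is a formal difference `μ - ν` of
two positive ones (both may be infinite, so `SignedMeasure` does not apply). -/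

/-- A kernel: a symmetric lower semicontinuous function `X × X → [0, ∞]`. -/
structure IsKernel (κ : X → X → ℝ≥0∞) : Prop where
  symm : ∀ x y, κ x y = κ y x
  lsc : LowerSemicontinuous fun p : X × X => κ p.1 p.2

/-- The potential `U^μ(x) = ∫ κ(x,y) dμ(y)` of a positive measure. -/
def potential (κ : X → X → ℝ≥0∞) (μ : Measure X) (x : X) : ℝ≥0∞ :=
  ∫⁻ y, κ x y ∂μ

/-- The mutual energy `I(μ,ν) = ∫ κ d(μ ⊗ ν)` of two positive measures. -/
def mutualEnergy (κ : X → X → ℝ≥0∞) (μ ν : Measure X) : ℝ≥0∞ :=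
  ∫⁻ p, κ p.1 p.2 ∂(μ.prod ν)

/-- The energy `I(μ) = I(μ,μ)`. -/
def energy (κ : X → X → ℝ≥0∞) (μ : Measure X) : ℝ≥0∞ :=
  mutualEnergy κ μ μ

/-- The cone `𝓔⁺` of positive Radon measures of finite energy. -/
def energyCone (κ : X → X → ℝ≥0∞) : Set (Measure X) :=
  {μ | IsLocallyFiniteMeasure μ ∧ energy κ μ < ∞}

/-- The class `𝓔⁺(A)` of the measures in `𝓔⁺` concentrated on the (arbitrary) set `A`, i.e. such
that the complement of `A` is negligible. -/
def energyConeOn (κ : X → X → ℝ≥0∞) (A : Set X) : Set (Measure X) :=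
  {μ | μ ∈ energyCone κ ∧ μ Aᶜ = 0}

/-- The measures of unit total mass in `𝓔⁺(A)`. -/
def unitEnergyConeOn (κ : X → X → ℝ≥0∞) (A : Set X) : Set (Measure X) :=
  {μ | μ ∈ energyConeOn κ A ∧ μ univ = 1}

/-- The squared energy distance `‖μ - ν‖² = I(μ) - 2 I(μ,ν) + I(ν)`, used only for `μ, ν ∈ 𝓔⁺`
(then, under the energy principle, all three terms are finite). -/
def strongDistSq (κ : X → X → ℝ≥0∞) (μ ν : Measure X) : ℝ :=
  (energy κ μ).toReal - 2 * (mutualEnergy κ μ ν).toReal + (energy κ ν).toReal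

/-- The energy principle (strict positive definiteness): `I(σ) ≥ 0` for every signed Radon measure
`σ = μ - ν` whose energy `I(μ) + I(ν) - 2 I(μ,ν)` is well defined, and `I(σ) = 0` only for `σ = 0`.
(If both `I(μ) + I(ν)` and `I(μ,ν)` are infinite, the energy is not defined, and the inequality
below holds trivially.) -/
def EnergyPrinciple (κ : X → X → ℝ≥0∞) : Prop :=
  ∀ μ ν : Measure X, IsLocallyFiniteMeasure μ → IsLocallyFiniteMeasure ν →
    2 * mutualEnergy κ μ ν ≤ energy κ μ + energy κ ν ∧
      (energy κ μ + energy κ ν < ∞ →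
        2 * mutualEnergy κ μ ν = energy κ μ + energy κ ν → μ = ν)

/-- The consistency principle: the cone `𝓔⁺` is complete in the strong topology, and on `𝓔⁺` the
strong topology is finer than the vague one. -/
structure ConsistencyPrinciple (κ : X → X → ℝ≥0∞) : Prop where
  complete : ∀ μ : ℕ → Measure X, (∀ n, μ n ∈ energyCone κ) →
    (∀ ε : ℝ, 0 < ε → ∃ N, ∀ m ≥ N, ∀ n ≥ N, strongDistSq κ (μ m) (μ n) < ε) →
    ∃ μ₀ ∈ energyCone κ, Tendsto (fun n => strongDistSq κ (μ n) μ₀) atTop (𝓝 0)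
  finer : ∀ μ₀ ∈ energyCone κ, ∀ φ : C_c(X, ℝ), ∀ ε : ℝ, 0 < ε → ∃ δ : ℝ, 0 < δ ∧
    ∀ μ ∈ energyCone κ, strongDistSq κ μ μ₀ < δ → |∫ x, φ x ∂μ - ∫ x, φ x ∂μ₀| < ε

/-- The domination principle. -/
def DominationPrinciple (κ : X → X → ℝ≥0∞) : Prop :=
  ∀ μ ∈ energyCone κ, ∀ ν : Measure X, IsLocallyFiniteMeasure ν →
    (∀ᵐ x ∂μ, potential κ μ x ≤ potential κ ν x) →
    ∀ x, potential κ μ x ≤ potential κ ν x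

/-- Frostman's maximum principle. -/
def FrostmanMaximumPrinciple (κ : X → X → ℝ≥0∞) : Prop :=
  ∀ μ ∈ energyCone κ, ∀ c : ℝ≥0, 0 < c →
    (∀ᵐ x ∂μ, potential κ μ x ≤ c) → ∀ x, potential κ μ x ≤ c

/-- The cone `𝓔⁺(A)` is strongly closed. (`𝓔⁺` being strongly complete, it does not matter whether
the closure is taken in `𝓔⁺` or in the space of signed measures of finite energy.) -/
def StronglyClosedCone (κ : X → X → ℝ≥0∞) (A : Set X) : Prop :=
  ∀ μ ∈ energyCone κ,
    (∀ ε : ℝ, 0 < ε → ∃ ν ∈ energyConeOn κ A, strongDistSq κ ν μ < ε) → μ ∈ energyConeOn κ A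

/-- The inner capacity `c_*(A) = sup c(K)` over the compact `K ⊆ A`, where `1 / c(K)` is the infimum
of the energies of the positive measures of unit mass concentrated on `K`. -/
def innerCapacity (κ : X → X → ℝ≥0∞) (A : Set X) : ℝ≥0∞ :=
  ⨆ (K : Set X) (_ : IsCompact K) (_ : K ⊆ A),
    (⨅ (μ : Measure X) (_ : μ Kᶜ = 0) (_ : μ univ = 1), energy κ μ)⁻¹

/-- `P` holds nearly everywhere on `A`: the exceptional subset of `A` has inner capacity zero. -/
def NearlyEverywhereOn (κ : X → X → ℝ≥0∞) (A : Set X) (P : X → Prop) : Prop :=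
  innerCapacity κ {x | x ∈ A ∧ ¬ P x} = 0

/-- The standing assumption on the charge `ω` creating the external field: `ω` is a nonzero positive
Radon measure which either has finite energy, or is bounded with potential bounded on `A` and
upper semicontinuous (hence continuous) on each compact subset of `A`. -/
def AdmissibleCharge (κ : X → X → ℝ≥0∞) (A : Set X) (ω : Measure X) : Prop :=
  IsLocallyFiniteMeasure ω ∧ ω ≠ 0 ∧
    (ω ∈ energyCone κ ∨
      (ω univ < ∞ ∧
        (∀ K : Set X, IsCompact K → K ⊆ A → UpperSemicontinuousOn (potential κ ω) K) ∧
        (⨆ x ∈ A, potential κ ω x) < ∞))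

/-- The property defining the inner balayage of `ω` onto `A`: it is the only measure `β ∈ 𝓔⁺(A)`
with `U^β = U^ω` nearly everywhere on `A`. -/
def IsInnerBalayage (κ : X → X → ℝ≥0∞) (A : Set X) (ω β : Measure X) : Prop :=
  β ∈ energyConeOn κ A ∧ NearlyEverywhereOn κ A fun x => potential κ β x = potential κ ω x

open Classical in
/-- The inner balayage `ω^A` (the zero measure if there were none). -/
def innerBalayage (κ : X → X → ℝ≥0∞) (A : Set X) (ω : Measure X) : Measure X :=
  if h : ∃ β, IsInnerBalayage κ A ω β then h.choose else 0

/-- The Gauss functional `I_f(μ) = ‖μ‖² + 2 ∫ f dμ` for the external field `f = -U^ω`. It is used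
only for `μ ∈ 𝓔⁺(A)` of unit mass, for which (with `ω` admissible) both terms are finite. -/
def gaussFunctional (κ : X → X → ℝ≥0∞) (ω μ : Measure X) : ℝ :=
  (energy κ μ).toReal - 2 * (∫⁻ x, potential κ ω x ∂μ).toReal

/-- `lam` solves the inner Gauss variational problem: it minimizes `I_f` over the measures of unit
mass in `𝓔⁺(A)`. -/
def IsGaussMinimizer (κ : X → X → ℝ≥0∞) (A : Set X) (ω lam : Measure X) : Prop :=
  lam ∈ unitEnergyConeOn κ A ∧
    ∀ μ ∈ unitEnergyConeOn κ A, gaussFunctional κ ω lam ≤ gaussFunctional κ ω μ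

end

end Balayage

/-! Measures of finite energy do not charge sets of inner capacity zero, so on `𝓔⁺(A)` the potential
`U^ω` may be replaced by `U^β` with `β = ω^A`, and the Gauss functional becomes `‖μ - β‖² - ‖β‖²`.
The problem is thus to project `β` onto a convex set. Unit mass may be lost in a strong limit, but
mass at most one is kept; the projection `λ` is therefore taken over mass at most one, where
completeness and the parallelogram identity provide it.

Put `c = ∫ (U^β - U^λ) dλ`. The variational inequality says `∫ (U^β - U^λ) dμ ≤ c μ(X)` for
competitors `μ` of finite mass (`mul_toReal_le_of_isMinOn`). The competitor `0` gives `c ≥ 0`, and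
`c = 0` would force `λ = β`, although `β(X) > 1` (`pairing_lt_of_isMinOn`). With `c > 0`, the choice
`μ = λ` yields `λ(X) = 1`, so `λ` solves the original problem. Restrictions of `λ` then give `∫_s
U^β dλ ≥ c λ(s)` for Borel `s`. Since `U^β = U^ω` λ-a.e. and `U^ω` tends to zero along `A`, no mass
of `λ` lies outside a large compact set. -/

namespace Balayage

/-! ### Energy pairing and consequences of the energy principle -/

section Pairing

variable {X : Type*} [MeasurableSpace X] {κ : X → X → ℝ≥0∞} {μ ν β : Measure X}

/-- The mutual energy of two measures of finite energy, as a real number. -/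
noncomputable def pairing (κ : X → X → ℝ≥0∞) (μ ν : Measure X) : ℝ :=
  (mutualEnergy κ μ ν).toReal

theorem strongDistSq_eq_pairing :
    strongDistSq κ μ ν = pairing κ μ μ - 2 * pairing κ μ ν + pairing κ ν ν := rfl

/-- The functional `μ ↦ ‖μ - β‖² - ‖β‖²`. -/
noncomputable def shiftedEnergy (κ : X → X → ℝ≥0∞) (β μ : Measure X) : ℝ :=
  pairing κ μ μ - 2 * pairing κ β μ

theorem smul_add_smul_univ (s t : ℝ≥0) :
    (s • μ + t • ν) univ = s * μ univ + t * ν univ := rfl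

variable [TopologicalSpace X]

/-- A nonzero value cannot be the default branch of the definition, so existence of the balayage
need not be assumed. -/
theorem isInnerBalayage_innerBalayage {A : Set X} {ω : Measure X}
    (h : innerBalayage κ A ω ≠ 0) :
    IsInnerBalayage κ A ω (innerBalayage κ A ω) := by
  unfold innerBalayage at h ⊢
  split_ifs at h ⊢ with hex
  · exact hex.choose_spec
  · exact absurd rfl h

theorem isLocallyFiniteMeasure_add [IsLocallyFiniteMeasure μ] [IsLocallyFiniteMeasure ν] :
    IsLocallyFiniteMeasure (μ + ν) := by
  refine ⟨fun x => ?_⟩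
  obtain ⟨s, hs, hμs⟩ := μ.finiteAt_nhds x
  obtain ⟨t, ht, hνt⟩ := ν.finiteAt_nhds x
  refine ⟨s ∩ t, inter_mem hs ht, ?_⟩
  rw [Measure.add_apply]
  exact ENNReal.add_lt_top.2 ⟨(measure_mono inter_subset_left).trans_lt hμs,
    (measure_mono inter_subset_right).trans_lt hνt⟩

theorem isLocallyFiniteMeasure_of_le [IsLocallyFiniteMeasure ν] (h : μ ≤ ν) :
    IsLocallyFiniteMeasure μ :=
  ⟨fun x => (ν.finiteAt_nhds x).imp fun _ hs => ⟨hs.1, (h _).trans_lt hs.2⟩⟩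

/-- Follows from `2 I(μ,ν) ≤ I(μ) + I(ν)`; it makes the real-valued pairing faithful on `𝓔⁺`. -/
theorem EnergyPrinciple.mutualEnergy_ne_top (hE : EnergyPrinciple κ) (hμ : μ ∈ energyCone κ)
    (hν : ν ∈ energyCone κ) : mutualEnergy κ μ ν ≠ ∞ := by
  intro h
  have h1 := (hE μ ν hμ.1 hν.1).1
  rw [h, ENNReal.mul_top two_ne_zero, top_le_iff] at h1
  exact (ENNReal.add_lt_top.2 ⟨hμ.2, hν.2⟩).ne h1

theorem EnergyPrinciple.strongDistSq_nonneg (hE : EnergyPrinciple κ) (hμ : μ ∈ energyCone κ)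
    (hν : ν ∈ energyCone κ) : 0 ≤ strongDistSq κ μ ν := by
  have h := ENNReal.toReal_mono (ENNReal.add_lt_top.2 ⟨hμ.2, hν.2⟩).ne (hE μ ν hμ.1 hν.1).1
  rw [ENNReal.toReal_mul, ENNReal.toReal_add hμ.2.ne hν.2.ne, ENNReal.toReal_ofNat] at h
  rw [strongDistSq]
  linarith

theorem EnergyPrinciple.eq_of_strongDistSq_nonpos (hE : EnergyPrinciple κ)
    (hμ : μ ∈ energyCone κ) (hν : ν ∈ energyCone κ) (h : strongDistSq κ μ ν ≤ 0) : μ = ν := by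
  have hlt := ENNReal.add_lt_top.2 ⟨hμ.2, hν.2⟩
  refine (hE μ ν hμ.1 hν.1).2 hlt ?_
  have h0 := h.antisymm (hE.strongDistSq_nonneg hμ hν)
  rw [← ENNReal.toReal_eq_toReal_iff' (ENNReal.mul_ne_top (by simp)
    (hE.mutualEnergy_ne_top hμ hν)) hlt.ne, ENNReal.toReal_mul,
    ENNReal.toReal_add hμ.2.ne hν.2.ne, ENNReal.toReal_ofNat]
  rw [strongDistSq] at h0
  linarith

theorem EnergyPrinciple.neg_pairing_le_shiftedEnergy (hE : EnergyPrinciple κ)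
    (hβ : β ∈ energyCone κ) (hμ : μ ∈ energyCone κ) :
    -pairing κ β β ≤ shiftedEnergy κ β μ := by
  have := hE.strongDistSq_nonneg hβ hμ
  rw [strongDistSq_eq_pairing] at this
  rw [shiftedEnergy]
  linarith

theorem sigmaFinite_of_mem_energyCone [SecondCountableTopology X] (hμ : μ ∈ energyCone κ) : SigmaFinite μ :=
  have := hμ.1
  inferInstance

end Pairing

/-! ### Tonelli for the kernel: symmetry, additivity and monotonicity of mutual energy -/

section Kernel

variable {X : Type*} [TopologicalSpace X] [SecondCountableTopology X] [MeasurableSpace X]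
  [BorelSpace X] {κ : X → X → ℝ≥0∞}

theorem IsKernel.measurable (hκ : IsKernel κ) : Measurable fun p : X × X => κ p.1 p.2 :=
  hκ.lsc.measurable

theorem IsKernel.measurable_potential (hκ : IsKernel κ) (μ : Measure X) [SFinite μ] :
    Measurable (potential κ μ) :=
  hκ.measurable.lintegral_prod_right'

theorem IsKernel.mutualEnergy_eq_lintegral (hκ : IsKernel κ) (μ ν : Measure X) [SFinite ν] :
    mutualEnergy κ μ ν = ∫⁻ x, potential κ ν x ∂μ :=
  lintegral_prod _ hκ.measurable.aemeasurable

theorem IsKernel.mutualEnergy_comm (hκ : IsKernel κ) (μ ν : Measure X) [SFinite μ] [SFinite ν] :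
    mutualEnergy κ μ ν = mutualEnergy κ ν μ := by
  rw [mutualEnergy, lintegral_prod_symm' _ hκ.measurable, hκ.mutualEnergy_eq_lintegral]
  simp only [potential]
  exact lintegral_congr fun y => lintegral_congr fun x => hκ.symm x y

theorem IsKernel.mutualEnergy_add_left (hκ : IsKernel κ) (μ ν ρ : Measure X) [SFinite ρ] :
    mutualEnergy κ (μ + ν) ρ = mutualEnergy κ μ ρ + mutualEnergy κ ν ρ := by
  simp only [hκ.mutualEnergy_eq_lintegral, lintegral_add_measure]

theorem IsKernel.mutualEnergy_smul_left (hκ : IsKernel κ) (t : ℝ≥0) (μ ρ : Measure X)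
    [SFinite ρ] : mutualEnergy κ (t • μ) ρ = t * mutualEnergy κ μ ρ := by
  simp only [hκ.mutualEnergy_eq_lintegral, lintegral_smul_measure]
  rfl

theorem IsKernel.mutualEnergy_mono (hκ : IsKernel κ) {μ μ' ν ν' : Measure X} [SFinite μ]
    [SFinite μ'] [SFinite ν] [SFinite ν'] (hμ : μ ≤ μ') (hν : ν ≤ ν') :
    mutualEnergy κ μ ν ≤ mutualEnergy κ μ' ν' := by
  calc mutualEnergy κ μ ν ≤ mutualEnergy κ μ' ν := by
        simp only [hκ.mutualEnergy_eq_lintegral]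
        exact lintegral_mono' hμ le_rfl
    _ ≤ mutualEnergy κ μ' ν' := by
        rw [hκ.mutualEnergy_comm, hκ.mutualEnergy_comm μ' ν']
        simp only [hκ.mutualEnergy_eq_lintegral]
        exact lintegral_mono' hν le_rfl

end Kernel

/-! ### Pre-Hilbert geometry of `𝓔⁺` and projection onto convex sets -/

section Cone

variable {X : Type*} [TopologicalSpace X] [SecondCountableTopology X] [MeasurableSpace X]
  [BorelSpace X] {κ : X → X → ℝ≥0∞} {μ ν ρ : Measure X}

theorem IsKernel.mem_energyCone_of_le (hκ : IsKernel κ) (hν : ν ∈ energyCone κ) (h : μ ≤ ν) :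
    μ ∈ energyCone κ := by
  have := hν.1
  have : IsLocallyFiniteMeasure μ := isLocallyFiniteMeasure_of_le h
  exact ⟨this, (hκ.mutualEnergy_mono h h).trans_lt hν.2⟩

theorem IsKernel.smul_mem_energyCone (hκ : IsKernel κ) (t : ℝ≥0) (hμ : μ ∈ energyCone κ) :
    t • μ ∈ energyCone κ := by
  have := hμ.1
  refine ⟨inferInstance, ?_⟩
  rw [energy, hκ.mutualEnergy_smul_left, hκ.mutualEnergy_comm, hκ.mutualEnergy_smul_left]
  exact ENNReal.mul_lt_top ENNReal.coe_lt_top (ENNReal.mul_lt_top ENNReal.coe_lt_top hμ.2)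

theorem IsKernel.add_mem_energyCone (hκ : IsKernel κ) (hE : EnergyPrinciple κ)
    (hμ : μ ∈ energyCone κ) (hν : ν ∈ energyCone κ) : μ + ν ∈ energyCone κ := by
  have := hμ.1
  have := hν.1
  refine ⟨isLocallyFiniteMeasure_add, ?_⟩
  rw [energy, hκ.mutualEnergy_add_left, hκ.mutualEnergy_comm μ, hκ.mutualEnergy_comm ν,
    hκ.mutualEnergy_add_left, hκ.mutualEnergy_add_left]
  have h1 := hE.mutualEnergy_ne_top hμ hμ
  have h2 := hE.mutualEnergy_ne_top hμ hν
  have h3 := hE.mutualEnergy_ne_top hν hμ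
  have h4 := hE.mutualEnergy_ne_top hν hν
  exact lt_top_iff_ne_top.2 (by finiteness)

theorem IsKernel.pairing_comm (hκ : IsKernel κ) (hμ : μ ∈ energyCone κ) (hν : ν ∈ energyCone κ) :
    pairing κ μ ν = pairing κ ν μ := by
  have := sigmaFinite_of_mem_energyCone hμ
  have := sigmaFinite_of_mem_energyCone hν
  rw [pairing, hκ.mutualEnergy_comm, pairing]

theorem IsKernel.pairing_add_left (hκ : IsKernel κ) (hE : EnergyPrinciple κ)
    (hμ : μ ∈ energyCone κ) (hν : ν ∈ energyCone κ) (hρ : ρ ∈ energyCone κ) :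
    pairing κ (μ + ν) ρ = pairing κ μ ρ + pairing κ ν ρ := by
  have := sigmaFinite_of_mem_energyCone hρ
  rw [pairing, hκ.mutualEnergy_add_left, ENNReal.toReal_add (hE.mutualEnergy_ne_top hμ hρ)
    (hE.mutualEnergy_ne_top hν hρ), pairing, pairing]

theorem IsKernel.pairing_smul_left (hκ : IsKernel κ) (t : ℝ≥0) (hρ : ρ ∈ energyCone κ) :
    pairing κ (t • μ) ρ = t * pairing κ μ ρ := by
  have := sigmaFinite_of_mem_energyCone hρ
  rw [pairing, hκ.mutualEnergy_smul_left, ENNReal.toReal_mul, pairing, ENNReal.coe_toReal]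

theorem IsKernel.pairing_add_right (hκ : IsKernel κ) (hE : EnergyPrinciple κ)
    (hμ : μ ∈ energyCone κ) (hν : ν ∈ energyCone κ) (hρ : ρ ∈ energyCone κ) :
    pairing κ ρ (μ + ν) = pairing κ ρ μ + pairing κ ρ ν := by
  rw [hκ.pairing_comm hρ (hκ.add_mem_energyCone hE hμ hν), hκ.pairing_add_left hE hμ hν hρ,
    hκ.pairing_comm hρ hμ, hκ.pairing_comm hρ hν]

theorem IsKernel.pairing_smul_right (hκ : IsKernel κ) (t : ℝ≥0) (hμ : μ ∈ energyCone κ)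
    (hρ : ρ ∈ energyCone κ) : pairing κ ρ (t • μ) = t * pairing κ ρ μ := by
  rw [hκ.pairing_comm hρ (hκ.smul_mem_energyCone t hμ), hκ.pairing_smul_left t hρ,
    hκ.pairing_comm hρ hμ]

variable {β : Measure X}

/-- Serves both the parallelogram identity (`s = t = 1/2`) and the first variation (`s = 1 - t`). -/
theorem IsKernel.shiftedEnergy_smul_add_smul (hκ : IsKernel κ) (hE : EnergyPrinciple κ)
    (hβ : β ∈ energyCone κ) (hμ : μ ∈ energyCone κ) (hν : ν ∈ energyCone κ) (s t : ℝ≥0) :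
    shiftedEnergy κ β (s • μ + t • ν) =
      s ^ 2 * pairing κ μ μ + 2 * s * t * pairing κ μ ν + t ^ 2 * pairing κ ν ν
        - 2 * (s * pairing κ β μ + t * pairing κ β ν) := by
  have hs := hκ.smul_mem_energyCone s hμ
  have ht := hκ.smul_mem_energyCone t hν
  have hst := hκ.add_mem_energyCone hE hs ht
  rw [shiftedEnergy, hκ.pairing_add_left hE hs ht hst, hκ.pairing_add_right hE hs ht hs,
    hκ.pairing_add_right hE hs ht ht, hκ.pairing_add_right hE hs ht hβ,
    hκ.pairing_smul_left s hs, hκ.pairing_smul_left s ht, hκ.pairing_smul_left t hs,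
    hκ.pairing_smul_left t ht, hκ.pairing_smul_right s hμ hμ, hκ.pairing_smul_right s hμ hν,
    hκ.pairing_smul_right t hν hμ, hκ.pairing_smul_right t hν hν, hκ.pairing_smul_right s hμ hβ,
    hκ.pairing_smul_right t hν hβ, hκ.pairing_comm hν hμ]
  ring

/-- The parallelogram identity. -/
theorem IsKernel.strongDistSq_eq_shiftedEnergy (hκ : IsKernel κ) (hE : EnergyPrinciple κ)
    (hβ : β ∈ energyCone κ) (hμ : μ ∈ energyCone κ) (hν : ν ∈ energyCone κ) :
    strongDistSq κ μ ν = 2 * (shiftedEnergy κ β μ + shiftedEnergy κ β ν)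
      - 4 * shiftedEnergy κ β ((1 / 2 : ℝ≥0) • μ + (1 / 2 : ℝ≥0) • ν) := by
  rw [hκ.shiftedEnergy_smul_add_smul hE hβ hμ hν, strongDistSq_eq_pairing, shiftedEnergy,
    shiftedEnergy]
  push_cast
  ring

/-- Weighted form of the Cauchy–Schwarz inequality for `μ₀ - β` and `μ - μ₀`. -/
theorem IsKernel.neg_div_le_shiftedEnergy_sub (hκ : IsKernel κ) (hE : EnergyPrinciple κ)
    (hβ : β ∈ energyCone κ) (hμ : μ ∈ energyCone κ) (hν : ν ∈ energyCone κ) {t : ℝ≥0}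
    (ht : 0 < t) :
    -(strongDistSq κ ν β / t) - t * strongDistSq κ μ ν + strongDistSq κ μ ν
      ≤ shiftedEnergy κ β μ - shiftedEnergy κ β ν := by
  have ht' : (0 : ℝ) < t := ht
  have h1 := hκ.smul_mem_energyCone t hμ
  have h2 := hκ.smul_mem_energyCone t hν
  have ha := hκ.add_mem_energyCone hE hν h1
  have hb := hκ.add_mem_energyCone hE hβ h2
  -- This is `‖(ν - β) + t(μ - ν)‖² ≥ 0`, with the signed measure written as the difference of the
  -- positive measures `ν + tμ` and `β + tν`.
  have h := hE.strongDistSq_nonneg ha hb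
  rw [strongDistSq_eq_pairing, hκ.pairing_add_left hE hν h1 ha, hκ.pairing_add_left hE hβ h2 hb,
    hκ.pairing_add_left hE hν h1 hb, hκ.pairing_smul_left _ ha, hκ.pairing_smul_left _ hb,
    hκ.pairing_smul_left _ hb, hκ.pairing_add_right hE hν h1 hν, hκ.pairing_add_right hE hν h1 hμ,
    hκ.pairing_add_right hE hβ h2 hν, hκ.pairing_add_right hE hβ h2 hμ,
    hκ.pairing_add_right hE hβ h2 hβ, hκ.pairing_smul_right _ hμ hν,
    hκ.pairing_smul_right _ hμ hμ, hκ.pairing_smul_right _ hν hν, hκ.pairing_smul_right _ hν hμ,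
    hκ.pairing_smul_right _ hν hβ, hκ.pairing_comm hν hμ, hκ.pairing_comm hν hβ,
    hκ.pairing_comm hμ hβ] at h
  have key : -strongDistSq κ ν β - t ^ 2 * strongDistSq κ μ ν ≤
      t * (shiftedEnergy κ β μ - shiftedEnergy κ β ν - strongDistSq κ μ ν) := by
    simp only [strongDistSq_eq_pairing, shiftedEnergy, hκ.pairing_comm hν hβ]
    nlinarith [h]
  have key' := div_le_div_of_nonneg_right key ht'.le
  rw [mul_div_cancel_left₀ _ ht'.ne'] at key'
  have e : (-strongDistSq κ ν β - t ^ 2 * strongDistSq κ μ ν) / t =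
      -(strongDistSq κ ν β / t) - t * strongDistSq κ μ ν := by
    field_simp
  linarith

/-- The weighted inequality bounds the possible drop `d` in the limit by `Q / t`, where `Q = ‖ν -
β‖²`; as `t` is free, `d > 0` is impossible. The choice `t = (Q + 1) / d` also covers `Q = 0`. -/
theorem IsKernel.shiftedEnergy_le_of_tendsto (hκ : IsKernel κ) (hE : EnergyPrinciple κ)
    (hβ : β ∈ energyCone κ) (hν : ν ∈ energyCone κ) {u : ℕ → Measure X}
    (hu : ∀ n, u n ∈ energyCone κ) {m : ℝ}
    (hm : Tendsto (fun n => shiftedEnergy κ β (u n)) atTop (𝓝 m))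
    (hd : Tendsto (fun n => strongDistSq κ (u n) ν) atTop (𝓝 0)) :
    shiftedEnergy κ β ν ≤ m := by
  by_contra! hlt
  have hQ := hE.strongDistSq_nonneg hν hβ
  set Q := strongDistSq κ ν β
  set d := shiftedEnergy κ β ν - m with hd_def
  have hd0 : 0 < d := by linarith
  have ht : 0 < (Q + 1) / d := by positivity
  obtain ⟨t, htt⟩ : ∃ t : ℝ≥0, (t : ℝ) = (Q + 1) / d := ⟨⟨_, ht.le⟩, rfl⟩
  have ht0 : 0 < t := by rw [← NNReal.coe_pos, htt]; exact ht
  have h1 : Tendsto (fun n => -(Q / t) - t * strongDistSq κ (u n) ν + strongDistSq κ (u n) ν)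
      atTop (𝓝 (-(Q / t) - t * 0 + 0)) := ((tendsto_const_nhds).sub (hd.const_mul _)).add hd
  have h2 := le_of_tendsto_of_tendsto' h1 (hm.sub_const (shiftedEnergy κ β ν))
    fun n => hκ.neg_div_le_shiftedEnergy_sub hE hβ (hu n) hν ht0
  have h3 : d ≤ Q / t := by linarith
  rw [htt, div_div_eq_mul_div, le_div_iff₀ (by positivity)] at h3
  nlinarith

/-- A nonempty midpoint-convex set of measures of finite energy that is closed under strong limits
contains a measure nearest to `β`. -/
theorem IsKernel.exists_isMinOn_shiftedEnergy (hκ : IsKernel κ) (hE : EnergyPrinciple κ)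
    (hC : ConsistencyPrinciple κ) (hβ : β ∈ energyCone κ) {M : Set (Measure X)}
    (hM : M ⊆ energyCone κ) (hne : M.Nonempty)
    (hmid : ∀ μ ∈ M, ∀ ν ∈ M, (1 / 2 : ℝ≥0) • μ + (1 / 2 : ℝ≥0) • ν ∈ M)
    (hcl : ∀ u : ℕ → Measure X, (∀ n, u n ∈ M) → ∀ ν ∈ energyCone κ,
      Tendsto (fun n => strongDistSq κ (u n) ν) atTop (𝓝 0) → ν ∈ M) :
    ∃ lam ∈ M, IsMinOn (shiftedEnergy κ β) M lam := by
  have hbdd : BddBelow (shiftedEnergy κ β '' M) := by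
    refine ⟨-pairing κ β β, ?_⟩
    rintro _ ⟨μ, hμ, rfl⟩
    exact hE.neg_pairing_le_shiftedEnergy hβ (hM hμ)
  set m := sInf (shiftedEnergy κ β '' M)
  have hle : ∀ μ ∈ M, m ≤ shiftedEnergy κ β μ := fun μ hμ => csInf_le hbdd (mem_image_of_mem _ hμ)
  have hex : ∀ n : ℕ, ∃ μ ∈ M, shiftedEnergy κ β μ < m + 1 / ((n : ℝ) + 1) := by
    intro n
    have hpos : (0 : ℝ) < 1 / ((n : ℝ) + 1) := by positivity
    obtain ⟨_, ⟨μ, hμ, rfl⟩, hlt⟩ :=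
      exists_lt_of_csInf_lt (hne.image (shiftedEnergy κ β)) (lt_add_of_pos_right m hpos)
    exact ⟨μ, hμ, hlt⟩
  choose u huM hu using hex
  have hlim : Tendsto (fun n => shiftedEnergy κ β (u n)) atTop (𝓝 m) := by
    refine tendsto_of_tendsto_of_tendsto_of_le_of_le tendsto_const_nhds ?_
      (fun n => hle _ (huM n)) (fun n => (hu n).le)
    simpa using tendsto_one_div_add_atTop_nhds_zero_nat.const_add m
  obtain ⟨ν, hν, hdist⟩ := hC.complete u (fun n => hM (huM n)) fun ε hε => by
    -- Midpoints have value at least `m`, so the parallelogram identity bounds the squared distance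
    -- by `2(2m + 2·ε/4) - 4m = ε`.
    obtain ⟨N, hN⟩ := (Metric.tendsto_atTop.1 hlim) (ε / 4) (by positivity)
    refine ⟨N, fun i hi j hj => ?_⟩
    have hi' := (abs_lt.1 (hN i hi)).2
    have hj' := (abs_lt.1 (hN j hj)).2
    have := hle _ (hmid _ (huM i) _ (huM j))
    rw [hκ.strongDistSq_eq_shiftedEnergy hE hβ (hM (huM i)) (hM (huM j))]
    linarith
  refine ⟨ν, hcl u huM ν hν hdist, fun μ hμ => ?_⟩
  exact (hκ.shiftedEnergy_le_of_tendsto hE hβ hν (fun n => hM (huM n)) hlim hdist).trans (hle μ hμ)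

/-- A minimizer over a midpoint-convex set is unique. -/
theorem IsKernel.eq_of_isMinOn_shiftedEnergy (hκ : IsKernel κ) (hE : EnergyPrinciple κ)
    (hβ : β ∈ energyCone κ) {M : Set (Measure X)} (hM : M ⊆ energyCone κ)
    (hmid : ∀ μ ∈ M, ∀ ν ∈ M, (1 / 2 : ℝ≥0) • μ + (1 / 2 : ℝ≥0) • ν ∈ M)
    (hμ : μ ∈ M) (hν : ν ∈ M) (hμmin : IsMinOn (shiftedEnergy κ β) M μ)
    (hνmin : IsMinOn (shiftedEnergy κ β) M ν) : μ = ν := by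
  refine hE.eq_of_strongDistSq_nonpos (hM hμ) (hM hν) ?_
  rw [hκ.strongDistSq_eq_shiftedEnergy hE hβ (hM hμ) (hM hν)]
  have h1 := isMinOn_iff.1 hμmin _ (hmid μ hμ ν hν)
  have h2 := isMinOn_iff.1 hνmin _ (hmid μ hμ ν hν)
  linarith

/-- The variational inequality for a minimizer over a convex set. -/
theorem IsKernel.pairing_sub_le_of_isMinOn (hκ : IsKernel κ) (hE : EnergyPrinciple κ)
    (hβ : β ∈ energyCone κ) {M : Set (Measure X)} (hM : M ⊆ energyCone κ)
    (hconv : ∀ μ ∈ M, ∀ ν ∈ M, ∀ s t : ℝ≥0, s + t = 1 → s • μ + t • ν ∈ M)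
    (hμ : μ ∈ M) (hν : ν ∈ M) (hmin : IsMinOn (shiftedEnergy κ β) M μ) :
    pairing κ μ μ - pairing κ β μ ≤ pairing κ μ ν - pairing κ β ν := by
  have key : ∀ t : ℝ, 0 < t → t < 1 → 0 ≤ 2 * ((pairing κ μ ν - pairing κ β ν)
      - (pairing κ μ μ - pairing κ β μ)) + t * strongDistSq κ μ ν := by
    intro t h0 h1
    lift t to ℝ≥0 using h0.le
    have h1' : t ≤ 1 := by exact_mod_cast h1.le
    -- Moving from `μ` towards `ν` changes the functional by `t` times the expression in `key`;
    -- dividing by `t` and letting `t → 0+` leaves the first variation.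
    have h := isMinOn_iff.1 hmin _ (hconv μ hμ ν hν (1 - t) t (tsub_add_cancel_of_le h1'))
    rw [hκ.shiftedEnergy_smul_add_smul hE hβ (hM hμ) (hM hν), shiftedEnergy,
      NNReal.coe_sub h1', NNReal.coe_one] at h
    rw [strongDistSq_eq_pairing]
    refine nonneg_of_mul_nonneg_right ?_ h0
    linarith
  have hlim : Tendsto (fun t : ℝ => 2 * ((pairing κ μ ν - pairing κ β ν)
      - (pairing κ μ μ - pairing κ β μ)) + t * strongDistSq κ μ ν) (𝓝[>] 0)
      (𝓝 (2 * ((pairing κ μ ν - pairing κ β ν) - (pairing κ μ μ - pairing κ β μ))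
        + 0 * strongDistSq κ μ ν)) :=
    (((continuous_id.mul continuous_const).const_add _).tendsto 0).mono_left nhdsWithin_le_nhds
  have := ge_of_tendsto hlim (by
    filter_upwards [Ioo_mem_nhdsGT (zero_lt_one' ℝ)] with t ht using key t ht.1 ht.2)
  linarith

end Cone

/-! ### The projection of `β` onto the measures of mass at most one -/

section ConeOn

variable {X : Type*} [TopologicalSpace X] [SecondCountableTopology X] [MeasurableSpace X]
  [BorelSpace X] {κ : X → X → ℝ≥0∞} {A : Set X} {μ ν ω β lam : Measure X}

theorem IsKernel.mem_energyConeOn_of_le (hκ : IsKernel κ) (hν : ν ∈ energyConeOn κ A)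
    (h : μ ≤ ν) : μ ∈ energyConeOn κ A :=
  ⟨hκ.mem_energyCone_of_le hν.1 h, le_antisymm ((h _).trans hν.2.le) zero_le⟩

theorem IsKernel.smul_mem_energyConeOn (hκ : IsKernel κ) (t : ℝ≥0) (hμ : μ ∈ energyConeOn κ A) :
    t • μ ∈ energyConeOn κ A :=
  ⟨hκ.smul_mem_energyCone t hμ.1, by rw [Measure.smul_apply, hμ.2, smul_zero]⟩

theorem IsKernel.smul_add_smul_mem_energyConeOn (hκ : IsKernel κ) (hE : EnergyPrinciple κ)
    (hμ : μ ∈ energyConeOn κ A) (hν : ν ∈ energyConeOn κ A) (s t : ℝ≥0) :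
    s • μ + t • ν ∈ energyConeOn κ A :=
  ⟨hκ.add_mem_energyCone hE (hκ.smul_mem_energyCone s hμ.1) (hκ.smul_mem_energyCone t hν.1), by
    rw [Measure.add_apply, Measure.smul_apply, Measure.smul_apply, hμ.2, hν.2, smul_zero,
      smul_zero, add_zero]⟩

/-- The measures of total mass at most one in `𝓔⁺(A)`. -/
def subunitEnergyConeOn (κ : X → X → ℝ≥0∞) (A : Set X) : Set (Measure X) :=
  {μ | μ ∈ energyConeOn κ A ∧ μ univ ≤ 1}

theorem IsKernel.smul_add_smul_mem_subunitEnergyConeOn (hκ : IsKernel κ) (hE : EnergyPrinciple κ)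
    (hμ : μ ∈ subunitEnergyConeOn κ A) (hν : ν ∈ subunitEnergyConeOn κ A) {s t : ℝ≥0}
    (hst : s + t = 1) : s • μ + t • ν ∈ subunitEnergyConeOn κ A := by
  refine ⟨hκ.smul_add_smul_mem_energyConeOn hE hμ.1 hν.1 s t, ?_⟩
  rw [smul_add_smul_univ]
  calc (s : ℝ≥0∞) * μ univ + t * ν univ ≤ s * 1 + t * 1 := by gcongr; exacts [hμ.2, hν.2]
    _ = 1 := by rw [mul_one, mul_one, ← ENNReal.coe_add, hst, ENNReal.coe_one]

theorem IsKernel.smul_add_smul_mem_unitEnergyConeOn (hκ : IsKernel κ) (hE : EnergyPrinciple κ)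
    (hμ : μ ∈ unitEnergyConeOn κ A) (hν : ν ∈ unitEnergyConeOn κ A) {s t : ℝ≥0}
    (hst : s + t = 1) : s • μ + t • ν ∈ unitEnergyConeOn κ A := by
  refine ⟨hκ.smul_add_smul_mem_energyConeOn hE hμ.1 hν.1 s t, ?_⟩
  rw [smul_add_smul_univ, hμ.2, hν.2, mul_one, mul_one, ← ENNReal.coe_add, hst, ENNReal.coe_one]

/-- If a measure in `𝓔⁺(A)` minimizes the distance to `β` among those of mass at most one, then its
signed distance to `β` is, against any competitor of finite mass, at least proportional to the
mass. -/
theorem IsKernel.mul_toReal_le_of_isMinOn (hκ : IsKernel κ) (hE : EnergyPrinciple κ)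
    (hβ : β ∈ energyCone κ) (hlam : lam ∈ subunitEnergyConeOn κ A)
    (hmin : IsMinOn (shiftedEnergy κ β) (subunitEnergyConeOn κ A) lam)
    (hμ : μ ∈ energyConeOn κ A) (hfin : μ univ ≠ ∞) :
    (pairing κ lam lam - pairing κ β lam) * (μ univ).toReal ≤ pairing κ lam μ - pairing κ β μ := by
  rcases eq_or_ne (μ univ) 0 with h0 | h0
  · rw [Measure.measure_univ_eq_zero.1 h0]
    simp [pairing, mutualEnergy]
  have hpos : 0 < (μ univ).toReal := ENNReal.toReal_pos h0 hfin
  set t : ℝ≥0 := (μ univ).toNNReal⁻¹ with ht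
  have hmem : t • μ ∈ subunitEnergyConeOn κ A := by
    refine ⟨hκ.smul_mem_energyConeOn t hμ, ?_⟩
    have : (t • μ) univ = t * μ univ := rfl
    rw [this, ht, ENNReal.coe_inv (ENNReal.toNNReal_ne_zero.2 ⟨h0, hfin⟩),
      ENNReal.coe_toNNReal hfin, ENNReal.inv_mul_cancel h0 hfin]
  have h := hκ.pairing_sub_le_of_isMinOn hE hβ (fun _ h => h.1.1)
    (fun μ hμ ν hν s t hst => hκ.smul_add_smul_mem_subunitEnergyConeOn hE hμ hν hst)
    hlam hmem hmin
  rw [hκ.pairing_smul_right t hμ.1 hlam.1.1, hκ.pairing_smul_right t hμ.1 hβ, ← mul_sub] at h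
  have htr : (t : ℝ) = (μ univ).toReal⁻¹ := by rw [ht]; simp [ENNReal.toReal]
  rw [htr, ← div_eq_inv_mul, le_div_iff₀ hpos] at h
  exact h

/-- If `λ - β` is orthogonal to `λ` and nonnegative on the restrictions of `β`, then `λ = β`. -/
theorem IsKernel.eq_of_pairing_restrict_le (hκ : IsKernel κ) (hE : EnergyPrinciple κ)
    (hβ : β ∈ energyCone κ) (hlam : lam ∈ energyCone κ)
    (horth : pairing κ lam lam = pairing κ β lam)
    (h : ∀ s : Set X, β s ≠ ∞ → pairing κ β (β.restrict s) ≤ pairing κ lam (β.restrict s)) :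
    lam = β := by
  have := sigmaFinite_of_mem_energyCone hβ
  have := sigmaFinite_of_mem_energyCone hlam
  -- `β` may have infinite mass, so the hypothesis is applied on an exhaustion by sets of finite
  -- mass, followed by monotone convergence.
  have hle : mutualEnergy κ β β ≤ mutualEnergy κ lam β := by
    have hU : mutualEnergy κ β β = ⨆ n, ∫⁻ x in spanningSets β n, potential κ β x ∂β := by
      rw [hκ.mutualEnergy_eq_lintegral, ← setLIntegral_iUnion_of_directed _
        (monotone_spanningSets β).directed_le, iUnion_spanningSets, setLIntegral_univ]
    rw [hU]
    refine iSup_le fun n => ?_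
    have hr : β.restrict (spanningSets β n) ∈ energyCone κ :=
      hκ.mem_energyCone_of_le hβ Measure.restrict_le_self
    have hn := h _ (measure_spanningSets_lt_top β n).ne
    rw [pairing, pairing, ENNReal.toReal_le_toReal (hE.mutualEnergy_ne_top hβ hr)
      (hE.mutualEnergy_ne_top hlam hr), hκ.mutualEnergy_comm β, hκ.mutualEnergy_eq_lintegral] at hn
    exact hn.trans (hκ.mutualEnergy_mono le_rfl Measure.restrict_le_self)
  have hle' : pairing κ β β ≤ pairing κ lam β :=
    ENNReal.toReal_mono (hE.mutualEnergy_ne_top hlam hβ) hle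
  refine hE.eq_of_strongDistSq_nonpos hlam hβ ?_
  rw [strongDistSq_eq_pairing]
  have := hκ.pairing_comm hlam hβ
  linarith

/-- If `β ∈ 𝓔⁺(A)` has mass greater than one, the nearest point `λ` to `β` among the measures of
mass at most one satisfies `∫ (U^λ - U^β) dλ < 0`. -/
theorem IsKernel.pairing_lt_of_isMinOn (hκ : IsKernel κ) (hE : EnergyPrinciple κ)
    (hβ : β ∈ energyConeOn κ A) (hβmass : 1 < β univ) (hlam : lam ∈ subunitEnergyConeOn κ A)
    (hmin : IsMinOn (shiftedEnergy κ β) (subunitEnergyConeOn κ A) lam) :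
    pairing κ lam lam < pairing κ β lam := by
  have hle : pairing κ lam lam ≤ pairing κ β lam := by
    have h0 : (0 : ℝ≥0) • lam ∈ subunitEnergyConeOn κ A :=
      ⟨hκ.smul_mem_energyConeOn 0 hlam.1, by simp⟩
    have := hκ.pairing_sub_le_of_isMinOn hE hβ.1 (fun _ h => h.1.1)
      (fun μ hμ ν hν s t hst => hκ.smul_add_smul_mem_subunitEnergyConeOn hE hμ hν hst)
      hlam h0 hmin
    rw [hκ.pairing_smul_right 0 hlam.1.1 hlam.1.1, hκ.pairing_smul_right 0 hlam.1.1 hβ.1] at this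
    simp only [NNReal.coe_zero, zero_mul, sub_zero] at this
    linarith
  refine hle.lt_of_ne fun heq => ?_
  have hlamβ : lam = β := by
    refine hκ.eq_of_pairing_restrict_le hE hβ.1 hlam.1.1 heq fun s hs => ?_
    have := hκ.mul_toReal_le_of_isMinOn hE hβ.1 hlam hmin
      (hκ.mem_energyConeOn_of_le hβ (Measure.restrict_le_self (s := s)))
      (by rwa [Measure.restrict_apply_univ])
    rw [heq, sub_self, zero_mul] at this
    linarith
  exact absurd hlam.2 (not_le.2 (hlamβ ▸ hβmass))

/-- Tested against `λ` itself, the variational inequality reads `-c λ(X) ≤ -c` with `c > 0`, so the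
mass constraint is active. -/
theorem IsKernel.univ_eq_one_of_isMinOn (hκ : IsKernel κ) (hE : EnergyPrinciple κ)
    (hβ : β ∈ energyConeOn κ A) (hβmass : 1 < β univ) (hlam : lam ∈ subunitEnergyConeOn κ A)
    (hmin : IsMinOn (shiftedEnergy κ β) (subunitEnergyConeOn κ A) lam) : lam univ = 1 := by
  have hlt := hκ.pairing_lt_of_isMinOn hE hβ hβmass hlam hmin
  have h := hκ.mul_toReal_le_of_isMinOn hE hβ.1 hlam hmin hlam.1
    (hlam.2.trans_lt ENNReal.one_lt_top).ne
  refine le_antisymm hlam.2 ?_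
  have h1 : 1 ≤ (lam univ).toReal := by nlinarith
  rwa [← ENNReal.toReal_one, ENNReal.toReal_le_toReal ENNReal.one_ne_top
    (hlam.2.trans_lt ENNReal.one_lt_top).ne] at h1

theorem IsKernel.pairing_restrict (hκ : IsKernel κ) (hμ : μ ∈ energyCone κ)
    (hν : ν ∈ energyCone κ) (s : Set X) :
    pairing κ μ (ν.restrict s) = (∫⁻ x in s, potential κ μ x ∂ν).toReal := by
  have := sigmaFinite_of_mem_energyCone hμ
  have hr := hκ.mem_energyCone_of_le hν (Measure.restrict_le_self (s := s))
  rw [hκ.pairing_comm hμ hr, pairing, hκ.mutualEnergy_eq_lintegral]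

/-- On every Borel set the integral of `U^β` against the minimizer `λ` is at least
`∫ (U^β - U^λ) dλ` times the mass. -/
theorem IsKernel.mul_measure_le_setLIntegral_of_isMinOn (hκ : IsKernel κ) (hE : EnergyPrinciple κ)
    (hβ : β ∈ energyConeOn κ A) (hβmass : 1 < β univ) (hlam : lam ∈ subunitEnergyConeOn κ A)
    (hmin : IsMinOn (shiftedEnergy κ β) (subunitEnergyConeOn κ A) lam) {s : Set X}
    (hs : MeasurableSet s) :
    (pairing κ β lam - pairing κ lam lam) * (lam s).toReal ≤
      (∫⁻ x in s, potential κ β x ∂lam).toReal := by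
  have hr := hκ.mem_energyCone_of_le hlam.1.1 (Measure.restrict_le_self (s := s))
  -- The inequality bounds `∫ (U^β - U^λ)` from above, so it is tested on `sᶜ`; subtracting from the
  -- total `c` gives the lower bound `c λ(s)` on `s`, and `U^λ ≥ 0` is then dropped.
  have hrc := hκ.mem_energyConeOn_of_le hlam.1 (Measure.restrict_le_self (s := sᶜ))
  have hone := hκ.univ_eq_one_of_isMinOn hE hβ hβmass hlam hmin
  have hfin : lam univ ≠ ∞ := hone ▸ ENNReal.one_ne_top
  have h := hκ.mul_toReal_le_of_isMinOn hE hβ.1 hlam hmin hrc (by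
    rw [Measure.restrict_apply_univ]
    exact ((measure_mono (subset_univ _)).trans_lt hfin.lt_top).ne)
  rw [Measure.restrict_apply_univ] at h
  have hsplit : ∀ ρ ∈ energyCone κ, pairing κ ρ lam =
      pairing κ ρ (lam.restrict s) + pairing κ ρ (lam.restrict sᶜ) := fun ρ hρ => by
    rw [← hκ.pairing_add_right hE hr hrc.1 hρ, Measure.restrict_add_restrict_compl hs]
  have hmass : (lam s).toReal + (lam sᶜ).toReal = 1 := by
    rw [← ENNReal.toReal_add, measure_add_measure_compl hs, hone, ENNReal.toReal_one] <;>
    exact ((measure_mono (subset_univ _)).trans_lt hfin.lt_top).ne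
  have h1 := hsplit lam hlam.1.1
  have h2 := hsplit β hβ.1
  rw [← hκ.pairing_restrict hβ.1 hlam.1.1]
  have h3 : 0 ≤ pairing κ lam (lam.restrict s) := ENNReal.toReal_nonneg
  have h4 : (lam sᶜ).toReal = 1 - (lam s).toReal := by linarith
  rw [h4] at h
  nlinarith

end ConeOn

/-! ### Negligible sets, vague limits and compactness of the support -/

section Exceptional

variable {X : Type*} [TopologicalSpace X] [T2Space X] [LocallyCompactSpace X]
  [SecondCountableTopology X] [MeasurableSpace X] [BorelSpace X] {κ : X → X → ℝ≥0∞} {A : Set X}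
  {μ ν ω β lam : Measure X}

/-- A measure of finite energy does not charge sets of inner capacity zero. -/
theorem IsKernel.ae_of_nearlyEverywhereOn (hκ : IsKernel κ) (hμ : μ ∈ energyConeOn κ A)
    {P : X → Prop} (hP : MeasurableSet {x | P x}) (h : NearlyEverywhereOn κ A P) :
    ∀ᵐ x ∂μ, P x := by
  have := hμ.1.1
  -- `A` need not be Borel; `Nᶜ` is a Borel subset of `A` carrying `μ`.
  obtain ⟨N, hAN, hN, hμN⟩ := exists_measurable_superset_of_null hμ.2
  have hE : MeasurableSet (Nᶜ \ {x | P x}) := hN.compl.diff hP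
  rw [ae_iff]
  by_contra hne
  have hpos : 0 < μ (Nᶜ \ {x | P x}) := by
    rw [pos_iff_ne_zero]
    intro h0
    refine hne (measure_mono_null (fun x hx => ?_) (measure_union_null h0 hμN))
    by_cases hxN : x ∈ N
    · exact Or.inr hxN
    · exact Or.inl ⟨hxN, hx⟩
  obtain ⟨K, hK, hKc, hμK⟩ := hE.exists_lt_isCompact hpos
  have hfin : μ K ≠ ∞ := hKc.measure_lt_top.ne
  have hsub : K ⊆ {x | x ∈ A ∧ ¬ P x} := fun x hx =>
    ⟨by_contra fun hxA => (hK hx).1 (hAN hxA), (hK hx).2⟩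
  have hcap := h
  simp only [NearlyEverywhereOn, innerCapacity, ENNReal.iSup_eq_zero, ENNReal.inv_eq_zero,
    iInf_eq_top] at hcap
  set t : ℝ≥0 := (μ K).toNNReal⁻¹ with ht
  -- The normalized restriction is a unit measure of finite energy on `K`, which contradicts `c(K) =
  -- 0`.
  have hmem : t • μ.restrict K ∈ energyCone κ :=
    hκ.smul_mem_energyCone t (hκ.mem_energyCone_of_le hμ.1 Measure.restrict_le_self)
  refine hmem.2.ne (hcap K hKc hsub _ ?_ ?_)
  · rw [Measure.smul_apply, Measure.restrict_apply hKc.measurableSet.compl, compl_inter_self,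
      measure_empty, smul_zero]
  · have : (t • μ.restrict K) univ = t * μ.restrict K univ := rfl
    rw [this, Measure.restrict_apply_univ, ht,
      ENNReal.coe_inv (ENNReal.toNNReal_ne_zero.2 ⟨hμK.ne', hfin⟩),
      ENNReal.coe_toNNReal hfin, ENNReal.inv_mul_cancel hμK.ne' hfin]

theorem IsKernel.potential_ae_eq_of_isInnerBalayage (hκ : IsKernel κ) [SFinite ω]
    (hβ : IsInnerBalayage κ A ω β) (hμ : μ ∈ energyConeOn κ A) :
    potential κ β =ᵐ[μ] potential κ ω := by
  have := sigmaFinite_of_mem_energyCone hβ.1.1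
  exact hκ.ae_of_nearlyEverywhereOn hμ
    (measurableSet_eq_fun (hκ.measurable_potential β) (hκ.measurable_potential ω)) hβ.2

/-- `U^β = U^ω` holds μ-a.e., and `β`, unlike `ω`, always has finite energy: the Gauss problem
becomes a projection problem. -/
theorem IsKernel.gaussFunctional_eq_shiftedEnergy (hκ : IsKernel κ) [SFinite ω]
    (hβ : IsInnerBalayage κ A ω β) (hμ : μ ∈ energyConeOn κ A) :
    gaussFunctional κ ω μ = shiftedEnergy κ β μ := by
  have := sigmaFinite_of_mem_energyCone hβ.1.1
  rw [gaussFunctional, shiftedEnergy, hκ.pairing_comm hβ.1.1 hμ.1, pairing, pairing,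
    hκ.mutualEnergy_eq_lintegral μ β,
    lintegral_congr_ae (hκ.potential_ae_eq_of_isInnerBalayage hβ hμ), energy]

/-- The bound `μ(X) ≤ 1` is preserved under strong limits. -/
theorem ConsistencyPrinciple.univ_le_one_of_tendsto (hC : ConsistencyPrinciple κ)
    {u : ℕ → Measure X} (hu : ∀ n, u n ∈ energyCone κ) (hu1 : ∀ n, u n univ ≤ 1)
    (hν : ν ∈ energyCone κ) (hd : Tendsto (fun n => strongDistSq κ (u n) ν) atTop (𝓝 0)) :
    ν univ ≤ 1 := by
  have := hν.1
  by_contra! hlt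
  obtain ⟨K, -, hK, hνK⟩ := MeasurableSet.univ.exists_lt_isCompact hlt
  obtain ⟨f, hf1, -, hfc, hf01⟩ :=
    exists_continuous_one_zero_of_isCompact hK isClosed_empty (disjoint_empty K)
  let φ : C_c(X, ℝ) := ⟨f, hfc⟩
  have hφ : ∀ x, φ x = f x := fun _ => rfl
  have hφint : Integrable φ ν := φ.continuous.integrable_of_hasCompactSupport φ.hasCompactSupport
  have hKint : 1 < ∫ x, φ x ∂ν := by
    have h1 : (1 : ℝ) < ν.real K := by
      rw [Measure.real, ← ENNReal.toReal_one]
      exact (ENNReal.toReal_lt_toReal ENNReal.one_ne_top hK.measure_lt_top.ne).2 hνK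
    refine h1.trans_le ?_
    rw [← integral_indicator_one hK.measurableSet]
    refine integral_mono ?_ hφint fun x => ?_
    · exact (integrable_indicator_iff hK.measurableSet).2
        (integrableOn_const hK.measure_lt_top.ne)
    · by_cases hx : x ∈ K
      · simp [hx, hφ, hf1 hx]
      · simpa [hx, hφ] using (hf01 x).1
  -- Vague closeness within this gap would force `∫ φ d(u n) > 1`, although `φ ≤ 1` and `u n` has
  -- mass at most one.
  obtain ⟨δ, hδ, hδφ⟩ := hC.finer ν hν φ (∫ x, φ x ∂ν - 1) (by linarith)
  obtain ⟨n, hn⟩ := (hd.eventually_lt_const hδ).exists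
  have h2 := (abs_lt.1 (hδφ (u n) (hu n) hn)).1
  have h3 : ∫ x, φ x ∂(u n) ≤ 1 := by
    have hfin : IsFiniteMeasure (u n) := ⟨(hu1 n).trans_lt ENNReal.one_lt_top⟩
    calc ∫ x, φ x ∂(u n) ≤ ∫ _, (1 : ℝ) ∂(u n) :=
          integral_mono (φ.continuous.integrable_of_hasCompactSupport φ.hasCompactSupport)
            (integrable_const _) fun x => (hf01 x).2
      _ = (u n univ).toReal := by simp [Measure.real]
      _ ≤ 1 := ENNReal.toReal_mono ENNReal.one_ne_top (hu1 n)
  linarith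

theorem IsKernel.exists_isMinOn_subunitEnergyConeOn (hκ : IsKernel κ) (hE : EnergyPrinciple κ)
    (hC : ConsistencyPrinciple κ) (hA : StronglyClosedCone κ A) (hβ : β ∈ energyConeOn κ A) :
    ∃ lam ∈ subunitEnergyConeOn κ A,
      IsMinOn (shiftedEnergy κ β) (subunitEnergyConeOn κ A) lam := by
  refine hκ.exists_isMinOn_shiftedEnergy hE hC hβ.1 (fun _ h => h.1.1)
    ⟨(0 : ℝ≥0) • β, hκ.smul_mem_energyConeOn 0 hβ, by simp⟩
    (fun μ hμ ν hν => hκ.smul_add_smul_mem_subunitEnergyConeOn hE hμ hν (add_halves 1))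
    fun u hu ν hν hd => ⟨hA ν hν fun ε hε => ?_, ?_⟩
  · obtain ⟨n, hn⟩ := (hd.eventually_lt_const hε).exists
    exact ⟨u n, (hu n).1, hn⟩
  · exact hC.univ_le_one_of_tendsto (fun n => (hu n).1.1) (fun n => (hu n).2) hν hd

/-- If the potential of the charge tends to zero at infinity along `A`, the minimizer vanishes
outside some compact set. -/
theorem IsKernel.isCompact_support_of_isMinOn (hκ : IsKernel κ) (hE : EnergyPrinciple κ)
    [SFinite ω] (hβ : IsInnerBalayage κ A ω β) (hβmass : 1 < β univ)
    (hlim : Tendsto (potential κ ω) (cocompact X ⊓ 𝓟 A) (𝓝 0))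
    (hlam : lam ∈ subunitEnergyConeOn κ A)
    (hmin : IsMinOn (shiftedEnergy κ β) (subunitEnergyConeOn κ A) lam) :
    IsCompact lam.support := by
  have hlt := hκ.pairing_lt_of_isMinOn hE hβ.1 hβmass hlam hmin
  set c := pairing κ β lam - pairing κ lam lam with hc_def
  have hc : 0 < c := sub_pos.2 hlt
  -- With `U^ω < c/2` on `A` outside `K`, the lower bound yields `c λ(Kᶜ) ≤ (c/2) λ(Kᶜ)`, hence
  -- `λ(Kᶜ) = 0`.
  have hev := hlim.eventually (gt_mem_nhds (ENNReal.ofReal_pos.2 (half_pos hc)))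
  rw [eventually_inf_principal, (hasBasis_cocompact).eventually_iff] at hev
  obtain ⟨K, hK, hKA⟩ := hev
  suffices h0 : lam Kᶜ = 0 from
    hK.of_isClosed_subset Measure.isClosed_support
      (Measure.support_subset_of_isClosed hK.isClosed (mem_ae_iff.2 h0))
  have hone := hκ.univ_eq_one_of_isMinOn hE hβ.1 hβmass hlam hmin
  have hfin : lam Kᶜ ≠ ∞ :=
    ((measure_mono (subset_univ _)).trans_lt (hone ▸ ENNReal.one_lt_top)).ne
  have hle := hκ.mul_measure_le_setLIntegral_of_isMinOn hE hβ.1 hβmass hlam hmin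
    hK.measurableSet.compl
  have hAae : ∀ᵐ x ∂lam, x ∈ A := mem_ae_iff.2 hlam.1.2
  have hbound : ∫⁻ x in Kᶜ, potential κ β x ∂lam ≤ ENNReal.ofReal (c / 2) * lam Kᶜ := by
    rw [← setLIntegral_const]
    refine lintegral_mono_ae ((ae_restrict_iff' hK.measurableSet.compl).2 ?_)
    filter_upwards [hAae, hκ.potential_ae_eq_of_isInnerBalayage hβ hlam.1] with x hxA hx hxK
    rw [hx]
    exact (hKA hxK hxA).le
  have hle' := hle.trans (ENNReal.toReal_mono (by finiteness) hbound)
  rw [ENNReal.toReal_mul, ENNReal.toReal_ofReal (half_pos hc).le] at hle'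
  have hnn : 0 ≤ (lam Kᶜ).toReal := ENNReal.toReal_nonneg
  have hz : (lam Kᶜ).toReal = 0 := by nlinarith
  exact ((ENNReal.toReal_eq_zero_iff _).1 hz).resolve_right hfin

end Exceptional

end Balayage

/-! ### The main theorem -/

open Balayage in
theorem mainTheorem8 {X : Type*} [TopologicalSpace X] [T2Space X] [LocallyCompactSpace X]
    [SecondCountableTopology X] [MeasurableSpace X] [BorelSpace X]
    (κ : X → X → ℝ≥0∞) (hκ : Balayage.IsKernel κ)
    (henergy : Balayage.EnergyPrinciple κ)
    (hconsistent : Balayage.ConsistencyPrinciple κ)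
    (hdomination : Balayage.DominationPrinciple κ)
    (hfrostman : Balayage.FrostmanMaximumPrinciple κ)
    (A : Set X) (hcap : 0 < Balayage.innerCapacity κ A)
    (hclosed : Balayage.StronglyClosedCone κ A)
    (ω : Measure X) (hω : Balayage.AdmissibleCharge κ A ω)
    (hunbounded : ¬ IsCompact (closure A))
    (hmass : 1 < Balayage.innerBalayage κ A ω univ)
    (hlim : Tendsto (Balayage.potential κ ω) (cocompact X ⊓ 𝓟 A) (𝓝 0)) :
    (∃! lam : Measure X, Balayage.IsGaussMinimizer κ A ω lam) ∧
      ∀ lam : Measure X, Balayage.IsGaussMinimizer κ A ω lam → IsCompact lam.support := by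
  have := hω.1
  set β := innerBalayage κ A ω
  have hβ : IsInnerBalayage κ A ω β := isInnerBalayage_innerBalayage fun h => by
    change 1 < β univ at hmass
    rw [show β = 0 from h] at hmass
    simp at hmass
  obtain ⟨lam, hlam, hmin⟩ :=
    hκ.exists_isMinOn_subunitEnergyConeOn henergy hconsistent hclosed hβ.1
  -- The relaxed minimizer already has unit mass, so it also minimizes over the smaller class of
  -- unit measures.
  have hone := hκ.univ_eq_one_of_isMinOn henergy hβ.1 hmass hlam hmin
  have hsub : unitEnergyConeOn κ A ⊆ subunitEnergyConeOn κ A := fun μ hμ => ⟨hμ.1, hμ.2.le⟩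
  have hgauss : ∀ μ, IsGaussMinimizer κ A ω μ ↔ μ ∈ unitEnergyConeOn κ A ∧
      IsMinOn (shiftedEnergy κ β) (unitEnergyConeOn κ A) μ := fun μ =>
    and_congr_right fun hμ => (forall₂_congr fun ν hν => by
      rw [hκ.gaussFunctional_eq_shiftedEnergy hβ hμ.1,
        hκ.gaussFunctional_eq_shiftedEnergy hβ hν.1]).trans isMinOn_iff.symm
  have hlamG : IsGaussMinimizer κ A ω lam :=
    (hgauss lam).2 ⟨⟨hlam.1, hone⟩, hmin.on_subset hsub⟩
  have huniq : ∀ μ, IsGaussMinimizer κ A ω μ → μ = lam := fun μ hμ =>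
    hκ.eq_of_isMinOn_shiftedEnergy henergy hβ.1.1 (fun _ h => h.1.1)
      (fun μ hμ ν hν => hκ.smul_add_smul_mem_unitEnergyConeOn henergy hμ hν (add_halves 1))
      hμ.1 hlamG.1 ((hgauss μ).1 hμ).2 ((hgauss lam).1 hlamG).2
  refine ⟨⟨lam, hlamG, huniq⟩, fun μ hμ => ?_⟩
  rw [huniq μ hμ]
  exact hκ.isCompact_support_of_isMinOn henergy hβ hmass hlim hlam hmin
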